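/- Let $q$ be a prime power and let $\mathbb{F}_q$ be the finite field with $q$ elements. A set $S \subseteq \mathbb{F}_q^n$ is called a $(k,m)$-Furstenberg set if for each linear subspace $W \subseteq \mathbb{F}_q^n$ of dimension $k$ there is $v \in \mathbb{F}_q^n$ with $|S \cap (v+W)| \geq m$. For $1 \leq k < n$ and $m \leq q^k$, let $K(q,n,k,m)$ be the least cardinality of a $(k,m)$-Furstenberg set in $\mathbb{F}_q^n$. **Theorem.** Let $\varepsilon > 0$ be real, let $q$ be a prime power, and let $n, k, m$ be integers with $2 \leq k < n$ and $m \leq q^k$. If $m \geq 2^{n+7-k}\, q\, \varepsilon^{-2}$, then $$K(q,n,k,m) \geq (1-\varepsilon)\, m\, q^{n-k}.$$ -/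

import Mathlib

open scoped Pointwise

/-- `S ⊆ F ^ n` is a `(k, m)`-Furstenberg set: every rank `k` linear subspace `W` of `F ^ n` has a
translate `v + W` that meets `S` in at least `m` points. -/
def IsFurstenberg {F : Type*} [Field F] {n : ℕ} (k m : ℕ) (S : Set (Fin n → F)) : Prop :=
  ∀ W : Submodule F (Fin n → F), Module.finrank F W = k →
    ∃ v : Fin n → F, m ≤ (S ∩ (v +ᵥ (W : Set (Fin n → F)))).ncard

/-- The least cardinality of a `(k, m)`-Furstenberg set in `F ^ n`, for a finite field `F`.
It is attained as soon as `m ≤ |F| ^ k`, see `isLeast_furstenbergNumber`. -/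
noncomputable def furstenbergNumber (F : Type*) [Field F] (n k m : ℕ) : ℕ :=
  sInf {t : ℕ | ∃ S : Set (Fin n → F), IsFurstenberg k m S ∧ S.ncard = t}

theorem isFurstenberg_univ {F : Type*} [Field F] [Finite F] {n k m : ℕ}
    (hm : m ≤ Nat.card F ^ k) : IsFurstenberg k m (Set.univ : Set (Fin n → F)) := by
  intro W hW
  refine ⟨0, ?_⟩
  have h : (W : Set (Fin n → F)).ncard = Nat.card F ^ k := by
    rw [← hW, ← Module.natCard_eq_pow_finrank (K := F) (V := W)]
    rfl
  simpa [h] using hm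

theorem isLeast_furstenbergNumber {F : Type*} [Field F] [Finite F] {n k m : ℕ}
    (hm : m ≤ Nat.card F ^ k) :
    IsLeast {t : ℕ | ∃ S : Set (Fin n → F), IsFurstenberg k m S ∧ S.ncard = t}
      (furstenbergNumber F n k m) :=
  ⟨Nat.sInf_mem ⟨_, Set.univ, isFurstenberg_univ hm, rfl⟩, fun _ ht => Nat.sInf_le ht⟩

/-! Project along a random subspace `H` of rank `k - 1` onto `F ^ d`, where `d = n - k + 1`. A rank
`k` space `W ⊇ H` becomes a line, and the `m` points of `S` in a translate of `W` are spread over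
its `q` points. Two distinct points of a translate of `W` are congruent modulo `H` with probability
at most `1 / q`, so for most `H` nearly all fibres on that line have size close to `m / q`. By the
same second moment bound (`sum_congruentPairs_le`) most fibres of the whole of `S` have size close
to `|S| / q ^ d`. If `|S| < (1 - ε) m q ^ (n - k)`, this mean is below `(1 - ε) m / q`. Hence the
heavy points of `F ^ d` are few, and yet they nearly fill a line in most directions.

The Kakeya maximal inequality `sum_lines_le` excludes this. It is proved by the method of
multiplicities: a polynomial of small degree vanishes at each `x` to an order proportional to `g x`;
its leading form then vanishes to high order at every direction whose line carries much weight
(`VanishesToOrder.homogeneousComponent`); and `card_mul_sum_vanishesToOrder_le` bounds the total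
order of vanishing.

"Heavy" is a truncated affine function of the fibre size, so quadratic polynomials bound all errors.
Bernoulli's inequality makes the maximal inequality linear as well (`one_le_of_sum_lines`), so the
condition can be averaged over `H` without choosing a good `H` (`one_le_of_rich_translates`). -/

/-- Evaluation of polynomials over an algebra `A` in an algebra `B`, given a map `A → B` and a
value for the variable. -/
noncomputable def Polynomial.evalAlgHom {F A B : Type*} [CommRing F] [CommRing A] [CommRing B]
    [Algebra F A] [Algebra F B] (f : A →ₐ[F] B) (b : B) : Polynomial A →ₐ[F] B :=
  Polynomial.eval₂AlgHom f b fun _ => Commute.all _ _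

@[simp]
theorem Polynomial.evalAlgHom_C {F A B : Type*} [CommRing F] [CommRing A] [CommRing B]
    [Algebra F A] [Algebra F B] (f : A →ₐ[F] B) (b : B) (a : A) :
    Polynomial.evalAlgHom f b (Polynomial.C a) = f a :=
  Polynomial.eval₂_C _ _

@[simp]
theorem Polynomial.evalAlgHom_X {F A B : Type*} [CommRing F] [CommRing A] [CommRing B]
    [Algebra F A] [Algebra F B] (f : A →ₐ[F] B) (b : B) :
    Polynomial.evalAlgHom f b Polynomial.X = b :=
  Polynomial.eval₂_X _ _

/-! ### Order of vanishing through Taylor expansion. -/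

namespace MvPolynomial

variable {F σ : Type*} [CommRing F]

/-- The expansion `P (x + s Y)` of `P` around the point `x`, as a polynomial in `s` whose
coefficients are polynomials in `Y`. -/
noncomputable def expandAt (x : σ → F) :
    MvPolynomial σ F →ₐ[F] Polynomial (MvPolynomial σ F) :=
  aeval fun i => Polynomial.C (C (x i)) + Polynomial.X * Polynomial.C (X i)

/-- `P` vanishes to order at least `N` at the point `x`. -/
def VanishesToOrder (P : MvPolynomial σ F) (x : σ → F) (N : ℕ) : Prop :=
  Polynomial.X ^ N ∣ expandAt x P

theorem eval₂_expandAt (P : MvPolynomial σ F) (x : σ → F) {B : Type*} [CommRing B] [Algebra F B]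
    (c : B) (b : σ → B) :
    Polynomial.eval₂ (aeval b : MvPolynomial σ F →ₐ[F] B).toRingHom c (expandAt x P) =
      aeval (fun i => algebraMap F B (x i) + c * b i) P := by
  have h : ((Polynomial.evalAlgHom (aeval b : MvPolynomial σ F →ₐ[F] B) c).comp (expandAt x)) =
      aeval (fun i => algebraMap F B (x i) + c * b i) := by
    ext i
    simp [expandAt, -Polynomial.X_mul_C]
  exact DFunLike.congr_fun h P

/-- Specializing the displacement `s Y` to `c b` in any algebra keeps the factor `s ^ N`. This one
substitution rule replaces all manipulation of Hasse derivatives. -/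
theorem VanishesToOrder.dvd_aeval {P : MvPolynomial σ F} {x : σ → F} {N : ℕ}
    (h : P.VanishesToOrder x N) {B : Type*} [CommRing B] [Algebra F B] (c : B) (b : σ → B) :
    c ^ N ∣ aeval (fun i => algebraMap F B (x i) + c * b i) P := by
  have := map_dvd (Polynomial.eval₂RingHom (aeval b : MvPolynomial σ F →ₐ[F] B).toRingHom c) h
  rw [map_pow, Polynomial.coe_eval₂RingHom, Polynomial.eval₂_X, eval₂_expandAt] at this
  exact this

/-- Putting `s = 1` and `Y = X - x` recovers `P`. -/
theorem expandAt_injective (x : σ → F) : Function.Injective (expandAt x) := by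
  intro P Q h
  have key (P : MvPolynomial σ F) := eval₂_expandAt P x (B := MvPolynomial σ F) 1
    (fun i => X i - C (x i))
  have h1 : (fun i => algebraMap F (MvPolynomial σ F) (x i) + 1 * (X i - C (x i))) = X := by
    ext1 i
    simp [algebraMap_eq]
  simp only [h1, aeval_X_left_apply] at key
  rw [← key P, ← key Q, h]

theorem natDegree_coeff_mul_le {A : Type*} [CommRing A] {p q : Polynomial (Polynomial A)}
    {a b : ℕ} (hp : ∀ r, (p.coeff r).natDegree ≤ a) (hq : ∀ r, (q.coeff r).natDegree ≤ b) (r : ℕ) :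
    ((p * q).coeff r).natDegree ≤ a + b := by
  rw [Polynomial.coeff_mul]
  exact Polynomial.natDegree_sum_le_of_forall_le _ _ fun i _ =>
    Polynomial.natDegree_mul_le_of_le (hp _) (hq _)

theorem natDegree_coeff_aeval_le {A : Type*} [CommRing A] [Algebra F A]
    {f : σ → Polynomial (Polynomial A)} (hf : ∀ i r, ((f i).coeff r).natDegree ≤ 1)
    (P : MvPolynomial σ F) (r : ℕ) : ((aeval f P).coeff r).natDegree ≤ P.totalDegree := by
  have key (s : σ →₀ ℕ) : ∀ r, ((s.prod fun i k => f i ^ k).coeff r).natDegree ≤ s.degree := by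
    induction s using Finsupp.induction_linear with
    | zero => intro r; simp [Polynomial.coeff_one]; split_ifs <;> simp
    | add s t hs ht =>
      intro r
      rw [Finsupp.prod_add_index' (by simp) (by simp [pow_add]), map_add]
      exact natDegree_coeff_mul_le hs ht r
    | single i k =>
      rw [Finsupp.prod_single_index (by simp), Finsupp.degree_single]
      induction k with
      | zero => intro r; simp [Polynomial.coeff_one]; split_ifs <;> simp
      | succ k ih => rw [pow_succ]; exact natDegree_coeff_mul_le ih (hf i)
  rw [P.as_sum, map_sum, Polynomial.finsetSum_coeff, ← P.as_sum]
  refine Polynomial.natDegree_sum_le_of_forall_le _ _ fun s hs => ?_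
  rw [aeval_monomial, Polynomial.algebraMap_apply, Polynomial.algebraMap_apply,
    Polynomial.coeff_C_mul]
  exact (Polynomial.natDegree_C_mul_le _ _).trans ((key s r).trans (le_totalDegree hs))

/-- In `P (u + t v)` only the monomials of top degree reach `t ^ deg P`, and each does so by taking
`t v` from every factor. This is how the leading form is read off from a line. -/
theorem coeff_aeval_add_X_mul {B : Type*} [CommRing B] [Algebra F B] (u v : σ → B)
    (P : MvPolynomial σ F) :
    (aeval (fun i => Polynomial.C (u i) + Polynomial.X * Polynomial.C (v i)) P).coeff
      P.totalDegree = aeval v (homogeneousComponent P.totalDegree P) := by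
  set f : σ → Polynomial B := fun i => Polynomial.C (u i) + Polynomial.X * Polynomial.C (v i)
  have key (s : σ →₀ ℕ) : (s.prod fun i k => f i ^ k).natDegree ≤ s.degree ∧
      (s.prod fun i k => f i ^ k).coeff s.degree = s.prod fun i k => v i ^ k := by
    induction s using Finsupp.induction_linear with
    | zero => simp
    | add s t hs ht =>
      rw [Finsupp.prod_add_index' (by simp) (by simp [pow_add]), map_add,
        Finsupp.prod_add_index' (by simp) (by simp [pow_add])]
      refine ⟨Polynomial.natDegree_mul_le_of_le hs.1 ht.1, ?_⟩
      rw [Polynomial.coeff_mul_add_eq_of_natDegree_le hs.1 ht.1, hs.2, ht.2]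
    | single i k =>
      rw [Finsupp.prod_single_index (by simp), Finsupp.prod_single_index (by simp),
        Finsupp.degree_single]
      have h1 : (f i).natDegree ≤ 1 := by simp only [f]; compute_degree
      refine ⟨by simpa using Polynomial.natDegree_pow_le_of_le k h1, ?_⟩
      have := Polynomial.coeff_pow_of_natDegree_le h1 (m := k)
      rw [mul_one] at this
      rw [this]
      simp [f, Polynomial.coeff_C]
  rw [homogeneousComponent_apply, map_sum, Finset.sum_filter]
  conv_lhs => rw [P.as_sum, map_sum, Polynomial.finsetSum_coeff, ← P.as_sum]
  refine Finset.sum_congr rfl fun s hs => ?_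
  rw [aeval_monomial, Polynomial.algebraMap_apply, Polynomial.coeff_C_mul]
  split_ifs with h
  · rw [aeval_monomial, ← h, (key s).2]
  · have : s.degree < P.totalDegree := lt_of_le_of_ne (le_totalDegree hs) h
    rw [Polynomial.coeff_eq_zero_of_natDegree_lt ((key s).1.trans_lt this), mul_zero]

end MvPolynomial

/-! ### Counting zeros with multiplicity. -/

/-- A coefficient of `Q(t, s)` vanishes as soon as the substitutions `s ↦ (t - t₀) s` force it to
have more zeros than its degree allows. -/
theorem Polynomial.coeff_eq_zero_of_dvd_comp {F A : Type*} [Field F] [Fintype F] [CommRing A]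
    [IsDomain A] [Algebra F A] (Q : Polynomial (Polynomial A)) (N : F → ℕ)
    (hQ : ∀ t, C (X - C (algebraMap F A t)) ^ N t ∣ Q.comp (C (X - C (algebraMap F A t)) * X))
    (r : ℕ) (hr : (Q.coeff r).natDegree < ∑ t, (N t - r)) : Q.coeff r = 0 := by
  -- The substitution multiplies coefficient `r` by `(X - t) ^ r`, so `N t - r` factors remain after
  -- cancelling.
  have hdvd (t : F) : (X - C (algebraMap F A t)) ^ (N t - r) ∣ Q.coeff r := by
    rcases le_total (N t) r with h | h
    · simp [Nat.sub_eq_zero_of_le h]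
    · have h1 := hQ t
      rw [← map_pow, C_dvd_iff_dvd_coeff] at h1
      have h2 := h1 r
      rw [comp_C_mul_X_coeff] at h2
      conv_lhs at h2 => rw [← Nat.sub_add_cancel h, pow_add]
      exact (mul_dvd_mul_iff_right (pow_ne_zero _ (X_sub_C_ne_zero _))).1 h2
  have hprod : ∏ t : F, (X - C (algebraMap F A t)) ^ (N t - r) ∣ Q.coeff r := by
    refine Fintype.prod_dvd_of_coprime (fun a b hab => ?_) hdvd
    refine (isCoprime_X_sub_C_of_isUnit_sub ?_).pow
    rw [← map_sub]
    exact (isUnit_iff_ne_zero.2 (sub_ne_zero.2 hab)).map _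
  refine eq_zero_of_dvd_of_natDegree_lt hprod ?_
  rw [natDegree_prod_of_monic _ _ fun t _ => (monic_X_sub_C _).pow _]
  simpa using hr

namespace MvPolynomial

variable {F : Type*} [Field F] [Fintype F]

/-- The **Schwartz-Zippel lemma with multiplicities** over a finite field. -/
theorem card_mul_sum_vanishesToOrder_le {d : ℕ} {P : MvPolynomial (Fin d) F} (hP : P ≠ 0)
    {N : (Fin d → F) → ℕ} (hN : ∀ x, P.VanishesToOrder x (N x)) :
    Fintype.card F * ∑ x, N x ≤ P.totalDegree * Fintype.card F ^ d := by
  induction d with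
  | zero =>
    rw [Fintype.sum_eq_zero, mul_zero]
    · exact Nat.zero_le _
    · intro x
      by_contra h0
      have h := (dvd_pow_self Polynomial.X h0).trans (hN x)
      rw [Polynomial.X_dvd_iff, P.eq_C_of_isEmpty] at h
      apply hP
      rw [P.eq_C_of_isEmpty, show coeff 0 P = 0 from ?_, C_0]
      simpa [expandAt, Polynomial.algebraMap_apply, algebraMap_eq] using h
  | succ d ih =>
    set q := Fintype.card F with hq
    set P' := finSuccEquiv F d P with hP'
    have hP'0 : P' ≠ 0 := EmbeddingLike.map_ne_zero_iff.2 hP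
    set L := P'.leadingCoeff with hL
    have hL0 : L ≠ 0 := by simpa [L] using hP'0
    set T := P'.natDegree with hT
    have hR0 (a : Fin d → F) : expandAt a L ≠ 0 := fun h =>
      hL0 (expandAt_injective a (h.trans (map_zero _).symm))
    -- `M a` is the exact order of vanishing at `a` of the leading coefficient in the first
    -- variable.
    set M : (Fin d → F) → ℕ := fun a => (expandAt a L).natTrailingDegree with hM
    have hLM (a) : L.VanishesToOrder a (M a) :=
      Polynomial.X_pow_dvd_iff.2 fun i hi => Polynomial.coeff_eq_zero_of_lt_natTrailingDegree hi
    have hdeg : L.totalDegree + T ≤ P.totalDegree :=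
      totalDegree_coeff_finSuccEquiv_add_le P T hL0
    have hline (a : Fin d → F) : ∑ t, (N (Fin.cons t a) - M a) ≤ T := by
      by_contra! hlt
      -- Expand `P (t, a + s Y)` in powers of `s`. The coefficient of `s ^ M a` has degree at most
      -- `T` in `t`, and its `t ^ T` coefficient is nonzero by the choice of `M a`. Too many zeros
      -- on the line would make it vanish.
      let θ : (MvPolynomial (Fin d) F) →ₐ[F] Polynomial (Polynomial (MvPolynomial (Fin d) F)) :=
        (Polynomial.mapAlgHom Polynomial.CAlgHom).comp (expandAt a)
      let Φ : Polynomial (MvPolynomial (Fin d) F) →ₐ[F] Polynomial (Polynomial (MvPolynomial (Fin d) F)) :=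
        Polynomial.evalAlgHom (A := MvPolynomial (Fin d) F)
          (B := Polynomial (Polynomial (MvPolynomial (Fin d) F))) θ (Polynomial.C Polynomial.X)
      let f : Fin (d + 1) → Polynomial (Polynomial (MvPolynomial (Fin d) F)) :=
        Fin.cons (Polynomial.C Polynomial.X) fun i =>
          Polynomial.C (Polynomial.C (C (a i))) +
            Polynomial.X * Polynomial.C (Polynomial.C (X i))
      have hΦ : Φ.comp (finSuccEquiv F d).toAlgHom = aeval f := by
        ext i : 1
        refine Fin.cases ?_ (fun i => ?_) i
        · simp [Φ, f, finSuccEquiv_X_zero]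
        · simp [Φ, f, θ, finSuccEquiv_X_succ, expandAt]
      have hcoeff (r : ℕ) : (aeval f P).coeff r =
          ∑ j ∈ Finset.range (T + 1),
            Polynomial.C ((expandAt a (P'.coeff j)).coeff r) * Polynomial.X ^ j := by
        rw [← hΦ]
        change (Polynomial.eval₂ θ.toRingHom (Polynomial.C Polynomial.X) P').coeff r = _
        rw [Polynomial.eval₂_eq_sum_range, Polynomial.finsetSum_coeff]
        refine Finset.sum_congr rfl fun j _ => ?_
        rw [← map_pow, Polynomial.coeff_mul_C]
        simp [θ]
      have hzero := Polynomial.coeff_eq_zero_of_dvd_comp (aeval f P)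
        (fun t => N (Fin.cons t a)) ?_ (M a) (lt_of_le_of_lt ?_ hlt)
      · have h1 := congrArg (Polynomial.coeff · T) hzero
        simp only [hcoeff, Polynomial.finsetSum_coeff, Polynomial.coeff_C_mul,
          Polynomial.coeff_X_pow, Polynomial.coeff_zero] at h1
        rw [Finset.sum_eq_single T (by intro b _ hb; simp [hb.symm]) (by simp)] at h1
        rw [if_pos rfl, mul_one] at h1
        exact Polynomial.coeff_natTrailingDegree_ne_zero.2 (hR0 a) h1
      · intro t
        set c : Polynomial (MvPolynomial (Fin d) F) := Polynomial.X - Polynomial.C (algebraMap F (MvPolynomial (Fin d) F) t) with hc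
        let Ψ : Polynomial (Polynomial (MvPolynomial (Fin d) F)) →ₐ[F] Polynomial (Polynomial (MvPolynomial (Fin d) F)) :=
          (Polynomial.aeval (Polynomial.C c * Polynomial.X)).restrictScalars F
        have hΨ : (Ψ.comp (aeval f) : MvPolynomial (Fin (d + 1)) F →ₐ[F] _) =
            aeval fun i => algebraMap F _ ((Fin.cons t a : Fin (d + 1) → F) i) + Polynomial.C c *
              (Fin.cons 1 (fun i => Polynomial.X * Polynomial.C (Polynomial.C (X i))) :
                Fin (d + 1) → Polynomial (Polynomial (MvPolynomial (Fin d) F))) i := by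
          ext i : 1
          refine Fin.cases ?_ (fun i => ?_) i
          · simp [Ψ, f, hc, Polynomial.algebraMap_apply]
          · simp [Ψ, f, hc, Polynomial.algebraMap_apply, algebraMap_eq]
            ring
        have h2 := (hN (Fin.cons t a)).dvd_aeval (Polynomial.C c)
          (Fin.cons 1 (fun i => Polynomial.X * Polynomial.C (Polynomial.C (X i))) :
                Fin (d + 1) → Polynomial (Polynomial (MvPolynomial (Fin d) F)))
        rw [← hΨ] at h2
        exact h2
      · rw [hcoeff]
        refine Polynomial.natDegree_sum_le_of_forall_le _ _ fun j hj => ?_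
        exact (Polynomial.natDegree_C_mul_X_pow_le _ _).trans (Finset.mem_range_succ_iff.1 hj)
    have hsum : ∑ x, N x = ∑ a, ∑ t, N (Fin.cons t a) := by
      rw [Finset.sum_comm, ← Fintype.sum_prod_type' (fun t a => N (Fin.cons t a))]
      exact (Fintype.sum_equiv (Fin.consEquiv fun _ => F) _ _ fun _ => rfl).symm
    have hline' (a : Fin d → F) : ∑ t, N (Fin.cons t a) ≤ T + q * M a := by
      calc ∑ t, N (Fin.cons t a) ≤ ∑ t, ((N (Fin.cons t a) - M a) + M a) :=
            Finset.sum_le_sum fun t _ => by omega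
        _ = ∑ t, (N (Fin.cons t a) - M a) + q * M a := by
            rw [Finset.sum_add_distrib]; simp [hq]
        _ ≤ _ := Nat.add_le_add_right (hline a) _
    calc q * ∑ x, N x ≤ q * ∑ a, (T + q * M a) := by
          rw [hsum]; exact Nat.mul_le_mul_left _ (Finset.sum_le_sum fun a _ => hline' a)
      _ = q * (T * q ^ d + q * ∑ a, M a) := by
          rw [Finset.sum_add_distrib, ← Finset.mul_sum]; simp [hq, mul_comm]
      _ ≤ q * (T * q ^ d + L.totalDegree * q ^ d) := by
          exact Nat.mul_le_mul_left _ (Nat.add_le_add_left (ih hL0 hLM) _)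
      _ = (L.totalDegree + T) * q ^ (d + 1) := by ring
      _ ≤ _ := Nat.mul_le_mul_right _ hdeg

/-- Consider `P (u + t w + s y)`. For `r < j` the coefficient of `s ^ r` has degree at most `deg P`
in `t` but more zeros than that, so `s ^ j` divides the whole polynomial. Passing to the top
coefficient in `t` turns this into vanishing of the leading form at `w`. -/
theorem X_pow_dvd_aeval_homogeneousComponent {σ A : Type*} [CommRing A] [IsDomain A] [Algebra F A]
    {P : MvPolynomial σ F} {u w : σ → F}
    {N : F → ℕ} (hN : ∀ t, P.VanishesToOrder (u + t • w) (N t)) {j : ℕ}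
    (hj : ∀ r < j, P.totalDegree < ∑ t, (N t - r)) (y : σ → A) :
    Polynomial.X ^ j ∣ aeval (fun i => Polynomial.C (algebraMap F A (w i)) +
      Polynomial.X * Polynomial.C (y i)) (MvPolynomial.homogeneousComponent P.totalDegree P) := by
  let f : σ → Polynomial (Polynomial A) := fun i =>
    (Polynomial.C (Polynomial.C (algebraMap F A (u i)) +
      Polynomial.X * Polynomial.C (algebraMap F A (w i)))) +
      Polynomial.X * Polynomial.C (Polynomial.C (y i))
  have hdvd : Polynomial.X ^ j ∣ aeval f P := by
    rw [Polynomial.X_pow_dvd_iff]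
    intro r hr
    refine Polynomial.coeff_eq_zero_of_dvd_comp _ N (fun t => ?_) r
      ((natDegree_coeff_aeval_le (fun i r => ?_) P r).trans_lt (hj r hr))
    · set c : Polynomial A := Polynomial.X - Polynomial.C (algebraMap F A t) with hc
      let Ψ : Polynomial (Polynomial A) →ₐ[F] Polynomial (Polynomial A) :=
        (Polynomial.aeval (Polynomial.C c * Polynomial.X)).restrictScalars F
      let b : σ → Polynomial (Polynomial A) := fun i =>
        Polynomial.C (Polynomial.C (algebraMap F A (w i))) +
          Polynomial.X * Polynomial.C (Polynomial.C (y i))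
      have hΨ : Ψ.comp (aeval f) =
          aeval fun i => algebraMap F _ ((u + t • w) i) + Polynomial.C c * b i := by
        ext i : 1
        simp only [AlgHom.comp_apply, aeval_X, Ψ, f, b, hc, Polynomial.algebraMap_apply,
          AlgHom.restrictScalars_apply, map_add, map_mul, map_sub, Polynomial.aeval_C,
          Polynomial.aeval_X, Pi.add_apply, Pi.smul_apply,
          smul_eq_mul, Polynomial.algebraMap_eq]
        ring
      have h2 := (hN t).dvd_aeval (Polynomial.C c) b
      rw [← hΨ] at h2
      exact h2
    · rcases r with _ | _ | r
      · simp only [f, Polynomial.coeff_add, Polynomial.coeff_C_zero, Polynomial.mul_coeff_zero,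
          Polynomial.coeff_X_zero, zero_mul, add_zero]
        compute_degree
      · simp [f, Polynomial.coeff_C]
      · simp [f]
  -- Substitute `s = t σ` and make `t` the outer variable. The result is `P (u + t (w + σ y))`,
  -- divisible by `σ ^ j`, and its coefficient of `t ^ deg P` is the leading form at `w + σ y`.
  let Θ : Polynomial (Polynomial A) →ₐ[F] Polynomial (Polynomial A) :=
    Polynomial.evalAlgHom (Polynomial.mapAlgHom Polynomial.CAlgHom)
      (Polynomial.X * Polynomial.C Polynomial.X)
  have hΘ : Θ.comp (aeval f) = aeval fun i =>
      Polynomial.C (Polynomial.C (algebraMap F A (u i))) + Polynomial.X *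
        Polynomial.C (Polynomial.C (algebraMap F A (w i)) + Polynomial.X * Polynomial.C (y i)) := by
    ext i : 1
    simp [Θ, f]
    ring
  have h3 : Polynomial.C (Polynomial.X ^ j) ∣ Θ (aeval f P) := by
    refine dvd_trans ?_ (map_dvd Θ hdvd)
    rw [map_pow, map_pow]
    refine pow_dvd_pow_of_dvd ?_ _
    simp [Θ]
  rw [← AlgHom.comp_apply, hΘ, Polynomial.C_dvd_iff_dvd_coeff] at h3
  have h4 := h3 P.totalDegree
  rw [coeff_aeval_add_X_mul] at h4
  exact h4

/-- If `P` vanishes to high order along a line, then its leading form vanishes to high order at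
the direction of the line. -/
theorem VanishesToOrder.homogeneousComponent {σ : Type*} {P : MvPolynomial σ F} {u w : σ → F}
    {N : F → ℕ} (hN : ∀ t, P.VanishesToOrder (u + t • w) (N t)) {j : ℕ}
    (hj : ∀ r < j, P.totalDegree < ∑ t, (N t - r)) :
    (MvPolynomial.homogeneousComponent P.totalDegree P).VanishesToOrder w j :=
  X_pow_dvd_aeval_homogeneousComponent hN hj X

end MvPolynomial

/-! ### Polynomials with prescribed orders of vanishing. -/

namespace MvPolynomial

/-- The exponents of the monomials of degree less than `k` in `d` variables. -/
def lowExponents (d k : ℕ) : Finset (Fin d →₀ ℕ) :=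
  (Finset.range k).biUnion fun i => Finset.univ.finsuppAntidiag i

theorem mem_lowExponents {d k : ℕ} {s : Fin d →₀ ℕ} : s ∈ lowExponents d k ↔ s.degree < k := by
  simp [lowExponents, Finset.mem_finsuppAntidiag, Finsupp.degree_eq_sum]

theorem card_lowExponents_succ (d k : ℕ) :
    (lowExponents d (k + 1)).card = (d + 1).multichoose k := by
  rw [lowExponents, Finset.card_biUnion]
  · simp only [Finset.card_finsuppAntidiag_nat_eq_multichoose, Finset.card_univ, Fintype.card_fin]
    induction k with
    | zero => simp
    | succ k ih => rw [Finset.sum_range_succ, ih, Nat.multichoose_succ_succ, add_comm]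
  · intro i _ j _ hij
    rw [Function.onFun, Finset.disjoint_left]
    intro s hs hs'
    rw [Finset.mem_finsuppAntidiag] at hs hs'
    exact hij (hs.1.symm.trans hs'.1)

theorem factorial_mul_card_lowExponents_succ (d k : ℕ) :
    d.factorial * (lowExponents d (k + 1)).card = (k + 1).ascFactorial d := by
  rw [card_lowExponents_succ, Nat.multichoose_eq, Nat.ascFactorial_eq_factorial_mul_choose,
    show d + 1 + k - 1 = k + d by omega, Nat.choose_symm_add]

theorem factorial_mul_card_lowExponents_le (d k : ℕ) :
    d.factorial * (lowExponents d k).card ≤ (k + d) ^ d := by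
  cases k with
  | zero => simp [lowExponents]
  | succ k =>
    rw [factorial_mul_card_lowExponents_succ]
    exact (Nat.ascFactorial_le_pow_add k d).trans (Nat.pow_le_pow_left (by omega) _)

theorem pow_le_factorial_mul_card_lowExponents (d k : ℕ) :
    (k + 1) ^ d ≤ d.factorial * (lowExponents d (k + 1)).card := by
  rw [factorial_mul_card_lowExponents_succ]
  exact Nat.pow_succ_le_ascFactorial _ _

theorem vanishesToOrder_of_coeff_eq_zero {F σ : Type*} [CommRing F] {P : MvPolynomial σ F}
    {x : σ → F} {N : ℕ} (h : ∀ s : σ →₀ ℕ, s.degree < N →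
      coeff s (aeval (fun i => X i + C (x i)) P) = 0) : P.VanishesToOrder x N := by
  have h1 : expandAt x P = aeval (fun i => Polynomial.X * Polynomial.C (X i))
      (aeval (fun i => X i + C (x i)) P) := by
    have : expandAt x = ((aeval (fun i => Polynomial.X * Polynomial.C (X i)) :
        MvPolynomial σ F →ₐ[F] Polynomial (MvPolynomial σ F)).comp
          (aeval (fun i => X i + C (x i)) : MvPolynomial σ F →ₐ[F] MvPolynomial σ F)) := by
      ext i : 1
      simp [expandAt, -Polynomial.X_mul_C, add_comm, Polynomial.algebraMap_apply, algebraMap_eq]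
    exact DFunLike.congr_fun this P
  set Q := aeval (fun i => X i + C (x i)) P
  rw [VanishesToOrder, h1, Q.as_sum, map_sum]
  refine Finset.dvd_sum fun s hs => ?_
  rw [aeval_monomial]
  have hs' : N ≤ s.degree := by
    by_contra! hlt
    exact mem_support_iff.1 hs (h s hlt)
  refine dvd_mul_of_dvd_right ((pow_dvd_pow _ hs').trans ?_) _
  simp only [mul_pow, Finsupp.prod_mul]
  refine dvd_mul_of_dvd_left ?_ _
  rw [Finsupp.prod, Finset.prod_pow_eq_pow_sum, Finsupp.degree_apply]

/-- The prescribed orders are homogeneous linear conditions on the coefficients, and by `h` there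
are fewer conditions than coefficients. -/
theorem exists_vanishesToOrder {F : Type*} [Field F] [Fintype F] {d D : ℕ} (N : (Fin d → F) → ℕ)
    (h : ∑ x, (lowExponents d (N x)).card < (lowExponents d (D + 1)).card) :
    ∃ P : MvPolynomial (Fin d) F, P ≠ 0 ∧ P.totalDegree ≤ D ∧
      ∀ x, P.VanishesToOrder x (N x) := by
  classical
  let L : (lowExponents d (D + 1) → F) →ₗ[F] MvPolynomial (Fin d) F :=
    ∑ s, (monomial s.1).comp (LinearMap.proj s)
  let T : (lowExponents d (D + 1) → F) →ₗ[F] ((Σ x, lowExponents d (N x)) → F) :=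
    LinearMap.pi fun p => (lcoeff F p.2.1).comp
      ((aeval (fun i => X i + C (p.1 i)) : MvPolynomial (Fin d) F →ₐ[F] _).toLinearMap.comp L)
  have hT : LinearMap.ker T ≠ ⊥ := by
    apply LinearMap.ker_ne_bot_of_finrank_lt
    rw [Module.finrank_fintype_fun_eq_card, Module.finrank_fintype_fun_eq_card]
    simpa using h
  obtain ⟨v, hv, hv0⟩ := Submodule.exists_mem_ne_zero_of_ne_bot hT
  have hLcoeff (s : lowExponents d (D + 1)) : coeff s.1 (L v) = v s := by
    simp only [L, LinearMap.sum_apply, LinearMap.comp_apply, LinearMap.proj_apply, coeff_sum,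
      coeff_monomial]
    rw [Finset.sum_eq_single s (by
      intro b _ hb
      rw [if_neg (fun h => hb (Subtype.ext h))]) (by simp), if_pos rfl]
  refine ⟨L v, fun h0 => hv0 ?_, ?_, fun x => ?_⟩
  · ext s
    rw [← hLcoeff, h0, coeff_zero, Pi.zero_apply]
  · simp only [L, LinearMap.sum_apply, LinearMap.comp_apply, LinearMap.proj_apply]
    refine totalDegree_finsetSum_le fun s _ => (totalDegree_monomial_le _ _).trans ?_
    exact Nat.lt_succ_iff.1 (mem_lowExponents.1 s.2)
  · refine vanishesToOrder_of_coeff_eq_zero fun s hs => ?_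
    exact congrFun (LinearMap.mem_ker.1 hv) ⟨x, s, mem_lowExponents.2 hs⟩

end MvPolynomial

/-! ### The Kakeya maximal inequality. -/

section Kakeya

open MvPolynomial

variable {F : Type*} [Field F] [Fintype F] [DecidableEq F]

/-- One factor `D` is the degree subtracted on each line, the other is the Schwartz-Zippel bound for
the leading form. -/
theorem sum_lines_le_of_card_lt {d D : ℕ} (N : (Fin d → F) → ℕ)
    (h : ∑ x, (lowExponents d (N x)).card < (lowExponents d (D + 1)).card)
    (u : (Fin d → F) → (Fin d → F)) :
    ∑ w with w ≠ 0, ∑ t : F, N (u w + t • w) ≤ 2 * D * Fintype.card F ^ d := by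
  obtain ⟨P, hP0, hPD, hP⟩ := exists_vanishesToOrder N h
  set q := Fintype.card F with hq
  have hq0 : 0 < q := Fintype.card_pos
  set E := P.totalDegree with hE
  set P' := homogeneousComponent E P with hP'
  have hP'0 : P' ≠ 0 := by
    intro h0
    have hne : P.support.Nonempty := support_nonempty.2 hP0
    obtain ⟨s, hs, hs'⟩ := Finset.exists_mem_eq_sup _ hne fun s : Fin d →₀ ℕ => s.sum fun _ e => e
    have h1 := congrArg (coeff s) h0
    rw [coeff_homogeneousComponent, if_pos (by rw [hE, totalDegree, hs']; rfl), coeff_zero] at h1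
    exact mem_support_iff.1 hs h1
  have hP'E : P'.totalDegree ≤ E := (homogeneousComponent_isHomogeneous E P).totalDegree_le
  let S : (Fin d → F) → ℕ := fun w => ∑ t : F, N (u w + t • w)
  -- For `w ≠ 0` this is `(S w - E) / q` rounded up, and `0` if negative: the least `j` for which `S
  -- w - q * j ≤ E`, so that zeros outnumber the degree for every `r < j`.
  let J : (Fin d → F) → ℕ := fun w => if w = 0 then 0 else (S w + (q - 1) - E) / q
  have hJ (w) : P'.VanishesToOrder w (J w) := by
    by_cases hw : w = 0
    · simp [J, hw, VanishesToOrder]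
    · refine VanishesToOrder.homogeneousComponent (u := u w) (fun t => hP _) fun r hr => ?_
      simp only [J, if_neg hw] at hr
      have h1 : (r + 1) * q ≤ S w + (q - 1) - E := (Nat.le_div_iff_mul_le hq0).1 hr
      have h2 : S w ≤ ∑ t : F, (N (u w + t • w) - r) + q * r := by
        calc S w ≤ ∑ t : F, ((N (u w + t • w) - r) + r) :=
              Finset.sum_le_sum fun t _ => by omega
          _ = _ := by rw [Finset.sum_add_distrib]; simp [hq]
      have h3 : (r + 1) * q = q * r + q := by ring
      omega
  have hSZ := card_mul_sum_vanishesToOrder_le hP'0 hJ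
  rw [← hq] at hSZ
  have hS (w) (hw : w ≠ 0) : S w ≤ q * J w + E := by
    simp only [J, if_neg hw]
    have := Nat.lt_mul_div_succ (S w + (q - 1) - E) hq0
    rw [mul_add, mul_one] at this
    omega
  calc ∑ w with w ≠ 0, S w ≤ ∑ w with w ≠ 0, (q * J w + E) :=
        Finset.sum_le_sum fun w hw => hS w (Finset.mem_filter.1 hw).2
    _ ≤ ∑ w, (q * J w + E) :=
        Finset.sum_le_sum_of_subset (Finset.filter_subset _ _)
    _ = q * ∑ w, J w + q ^ d * E := by
        rw [Finset.sum_add_distrib, Finset.mul_sum]; simp [hq]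
    _ ≤ D * q ^ d + q ^ d * D := by
        exact Nat.add_le_add (hSZ.trans (Nat.mul_le_mul_right _ (hP'E.trans hPD)))
          (Nat.mul_le_mul_left _ hPD)
    _ = _ := by ring

/-- The **Kakeya maximal inequality** over a finite field. -/
theorem sum_lines_le {d : ℕ} {g : (Fin d → F) → ℝ} (hg : ∀ x, 0 ≤ g x) {β : ℝ}
    (hβ0 : 0 ≤ β) (hβ : ∑ x, g x ^ d < β ^ d) (u : (Fin d → F) → (Fin d → F)) :
    ∑ w with w ≠ 0, ∑ t : F, g (u w + t • w) ≤ 2 * β * (Fintype.card F : ℝ) ^ d := by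
  set q := Fintype.card F with hq
  -- The integer case is applied to `⌊M g⌋` and `M` tends to infinity. The shift `d / M` comes from
  -- the bound `(k + d) ^ d` for `d!` times the number of low monomials; the strict inequality in
  -- `hβ` absorbs it.
  have hlim : Filter.Tendsto (fun M : ℕ => ∑ x, (g x + (d : ℝ) / (M : ℝ)) ^ d) Filter.atTop
      (nhds (∑ x, g x ^ d)) := by
    refine tendsto_finsetSum _ fun x _ => ?_
    have := ((tendsto_const_div_atTop_nhds_zero_nat (d : ℝ)).const_add (g x)).pow d
    simpa using this
  have hev := (hlim.eventually_lt_const hβ).and (Filter.eventually_gt_atTop 0)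
  have hlim2 : Filter.Tendsto (fun M : ℕ => 2 * β * (q : ℝ) ^ d + ((q : ℝ) ^ d * q) / (M : ℝ))
      Filter.atTop (nhds (2 * β * (q : ℝ) ^ d)) := by
    simpa using (tendsto_const_div_atTop_nhds_zero_nat ((q : ℝ) ^ d * q)).const_add
      (2 * β * (q : ℝ) ^ d)
  refine ge_of_tendsto hlim2 (hev.mono fun M hM => ?_)
  obtain ⟨hM, hM0⟩ := hM
  have hM0' : (0 : ℝ) < M := by exact_mod_cast hM0
  let N : (Fin d → F) → ℕ := fun x => ⌊M * g x⌋₊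
  have hNle (x) : (N x : ℝ) ≤ M * g x := Nat.floor_le (mul_nonneg hM0'.le (hg x))
  have hNge (x) : M * g x - 1 ≤ N x := (Nat.sub_one_lt_floor _).le
  have hcount : ∑ x, (lowExponents d (N x)).card < (lowExponents d (⌊M * β⌋₊ + 1)).card := by
    have hfac : 0 < d.factorial := d.factorial_pos
    refine lt_of_mul_lt_mul_left (a := d.factorial) ?_ hfac.le
    refine lt_of_lt_of_le ?_ (pow_le_factorial_mul_card_lowExponents d _)
    rw [Finset.mul_sum]
    refine lt_of_le_of_lt (Finset.sum_le_sum fun x _ => factorial_mul_card_lowExponents_le d _) ?_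
    have h1 : (M * β) ^ d ≤ ((⌊M * β⌋₊ : ℝ) + 1) ^ d :=
      pow_le_pow_left₀ (by positivity) (Nat.lt_floor_add_one _).le _
    have h2 : ∑ x, ((N x : ℝ) + d) ^ d ≤ M ^ d * ∑ x, (g x + (d : ℝ) / (M : ℝ)) ^ d := by
      rw [Finset.mul_sum]
      refine Finset.sum_le_sum fun x _ => ?_
      rw [← mul_pow, mul_add, mul_div_cancel₀ _ hM0'.ne']
      exact pow_le_pow_left₀ (by positivity) (by linarith [hNle x]) _
    have h3 : (M : ℝ) ^ d * ∑ x, (g x + (d : ℝ) / (M : ℝ)) ^ d < (M : ℝ) ^ d * β ^ d :=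
      mul_lt_mul_of_pos_left hM (by positivity)
    rw [← mul_pow] at h3
    exact_mod_cast h2.trans_lt (h3.trans_le h1)
  have key := sum_lines_le_of_card_lt N hcount u
  have key' : ∑ w with w ≠ 0, ∑ t : F, (N (u w + t • w) : ℝ) ≤ 2 * (M * β) * (q : ℝ) ^ d := by
    have h4 : (∑ w with w ≠ 0, ∑ t : F, (N (u w + t • w) : ℝ)) ≤
        2 * (⌊M * β⌋₊ : ℝ) * (q : ℝ) ^ d := by exact_mod_cast key
    refine h4.trans ?_
    gcongr
    exact Nat.floor_le (by positivity)
  have h5 : M * ∑ w with w ≠ 0, ∑ t : F, g (u w + t • w) ≤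
      2 * (M * β) * (q : ℝ) ^ d + (q : ℝ) ^ d * q := by
    calc M * ∑ w with w ≠ 0, ∑ t : F, g (u w + t • w)
        ≤ ∑ w with w ≠ 0, ∑ t : F, ((N (u w + t • w) : ℝ) + 1) := by
          rw [Finset.mul_sum]
          refine Finset.sum_le_sum fun w _ => ?_
          rw [Finset.mul_sum]
          exact Finset.sum_le_sum fun t _ => by linarith [hNge (u w + t • w)]
      _ = ∑ w with w ≠ 0, ∑ t : F, (N (u w + t • w) : ℝ) +
            ∑ w : Fin d → F with w ≠ 0, (q : ℝ) := by
          rw [← Finset.sum_add_distrib]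
          refine Finset.sum_congr rfl fun w _ => ?_
          rw [Finset.sum_add_distrib]
          simp [hq]
      _ ≤ 2 * (M * β) * (q : ℝ) ^ d + ∑ w : Fin d → F, (q : ℝ) := by
          refine add_le_add key' (Finset.sum_le_sum_of_subset_of_nonneg (Finset.filter_subset _ _)
            fun _ _ _ => by positivity)
      _ = _ := by simp [hq]
  rw [← mul_le_mul_iff_right₀ hM0']
  refine h5.trans (le_of_eq ?_)
  field_simp

/-- The Kakeya maximal inequality, with a weak bound on the `d`-th moment. -/
theorem sum_lines_le_of_sum_pow_le {d : ℕ} (hd : d ≠ 0) {g : (Fin d → F) → ℝ} (hg : ∀ x, 0 ≤ g x)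
    {β : ℝ} (hβ0 : 0 ≤ β) (hβ : ∑ x, g x ^ d ≤ β ^ d) (u : (Fin d → F) → (Fin d → F)) :
    ∑ w with w ≠ 0, ∑ t : F, g (u w + t • w) ≤ 2 * β * (Fintype.card F : ℝ) ^ d := by
  refine le_of_forall_pos_le_add fun ε hε => ?_
  have hq : (0 : ℝ) < Fintype.card F := by exact_mod_cast Fintype.card_pos
  set δ : ℝ := ε / (2 * (Fintype.card F : ℝ) ^ d) with hδ
  have hδ0 : 0 < δ := by positivity
  refine (sum_lines_le hg (by positivity : 0 ≤ β + δ)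
    (hβ.trans_lt (pow_lt_pow_left₀ (by linarith) hβ0 hd)) u).trans (le_of_eq ?_)
  rw [hδ]
  field_simp

end Kakeya

/-! ### Second moments modulo a random subspace. -/

section Subspaces

open scoped Classical in
/-- The subspaces of rank `r` contained in `W`. -/
noncomputable def subspacesIn {F V : Type*} [Field F] [AddCommGroup V] [Module F V]
    [Fintype (Submodule F V)] (W : Submodule F V) (r : ℕ) : Finset (Submodule F V) :=
  {H | H ≤ W ∧ Module.finrank F H = r}

open scoped Classical in
/-- The number of pairs of elements of `T` that are congruent modulo `H`. -/
noncomputable def congruentPairs {F V : Type*} [Field F] [AddCommGroup V] [Module F V]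
    (H : Submodule F V) (T : Finset V) : ℕ :=
  ((T ×ˢ T).filter fun p => p.1 - p.2 ∈ H).card

variable {F V : Type*} [Field F] [AddCommGroup V] [Module F V]

theorem mem_subspacesIn [Fintype (Submodule F V)] {W H : Submodule F V} {r : ℕ} :
    H ∈ subspacesIn W r ↔ H ≤ W ∧ Module.finrank F H = r := by
  simp [subspacesIn]

/-- If `z'` is a multiple of `z`, a scalar works. Otherwise take the transvection `x ↦ x + f x • (z'
- z)` with `f z = 1` and `f (z' - z) = 0`. Thus the number of rank `r` subspaces of `W` through a
nonzero vector of `W` does not depend on the vector. -/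
theorem exists_linearEquiv_apply_eq_map_le {z z' : V} (hz : z ≠ 0) (hz' : z' ≠ 0) :
    ∃ e : V ≃ₗ[F] V, e z = z' ∧ ∀ W : Submodule F V, z ∈ W → z' ∈ W →
      W.map (e : V →ₗ[F] V) ≤ W := by
  by_cases h : z ∈ Submodule.span F {z' - z}
  · obtain ⟨c, hc⟩ := Submodule.mem_span_singleton.1 h
    have hc0 : c ≠ 0 := by
      rintro rfl
      exact hz (by rw [← hc, zero_smul])
    have hzz : (c⁻¹ + 1) • z = z' := by
      rw [add_smul, one_smul]
      nth_rewrite 1 [← hc]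
      rw [smul_smul, inv_mul_cancel₀ hc0, one_smul, sub_add_cancel]
    have hb : c⁻¹ + 1 ≠ 0 := by
      intro h0
      rw [h0, zero_smul] at hzz
      exact hz' hzz.symm
    refine ⟨LinearEquiv.smulOfNeZero F V _ hb, hzz, fun W _ _ => ?_⟩
    rintro _ ⟨x, hx, rfl⟩
    exact W.smul_mem _ hx
  · obtain ⟨f, hfz, hf⟩ := Submodule.exists_le_ker_of_notMem h
    have hfv : ((f z)⁻¹ • f : Module.Dual F V) (z' - z) = 0 := by
      rw [LinearMap.smul_apply, show f (z' - z) = 0 from hf (Submodule.mem_span_singleton_self _),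
        smul_zero]
    refine ⟨LinearEquiv.transvection hfv, ?_, fun W hW hW' => ?_⟩
    · rw [LinearEquiv.transvection.apply, LinearMap.smul_apply, smul_eq_mul, inv_mul_cancel₀ hfz,
        one_smul, add_sub_cancel]
    · rintro _ ⟨x, hx, rfl⟩
      exact W.add_mem hx (W.smul_mem _ (W.sub_mem hW' hW))

open scoped Classical

theorem card_filter_mem_submodule [Fintype F] [Fintype V] (H : Submodule F V) :
    (Finset.univ.filter (· ∈ H)).card = Fintype.card F ^ Module.finrank F H := by
  rw [← Module.card_eq_pow_finrank (K := F) (V := H), Fintype.card_subtype]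

theorem congruentPairs_eq_sum {H : Submodule F V} (T : Finset V) :
    congruentPairs H T = ∑ p ∈ T ×ˢ T, if p.1 - p.2 ∈ H then 1 else 0 := by
  rw [congruentPairs, Finset.card_filter]

/-- The sum of the squares of the sizes of the fibres of `T` under a linear map. -/
theorem sum_card_fiber_sq {U : Type*} [AddCommGroup U] [Module F U] [Fintype U] [DecidableEq U] (φ : V →ₗ[F] U)
    (T : Finset V) :
    ∑ y, ((T.filter (φ · = y)).card : ℝ) ^ 2 = congruentPairs (LinearMap.ker φ) T := by
  have h : congruentPairs (LinearMap.ker φ) T = ∑ y, (T.filter (φ · = y)).card ^ 2 := by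
    rw [congruentPairs, Finset.card_eq_sum_card_fiberwise (f := fun p => φ p.1)
      (t := Finset.univ) (by simp)]
    refine Finset.sum_congr rfl fun y _ => ?_
    rw [sq, ← Finset.card_product]
    congr 1
    ext p
    simp only [Finset.mem_filter, Finset.mem_product, LinearMap.mem_ker, map_sub, sub_eq_zero]
    constructor
    · rintro ⟨⟨⟨h1, h2⟩, h3⟩, h4⟩
      exact ⟨⟨h1, h4⟩, h2, h3 ▸ h4⟩
    · rintro ⟨⟨h1, h4⟩, h2, h3⟩
      exact ⟨⟨⟨h1, h2⟩, h4.trans h3.symm⟩, h4⟩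
  rw [h]
  push_cast
  rfl

theorem sum_card_fiber {α U : Type*} [Fintype U] [DecidableEq U] (φ : α → U) (T : Finset α) :
    ∑ y, ((T.filter (φ · = y)).card : ℝ) = T.card := by
  rw [Finset.card_eq_sum_card_fiberwise (f := φ) (t := Finset.univ) (by simp)]
  push_cast
  rfl

variable [Fintype (Submodule F V)]

theorem card_filter_mem_subspacesIn_le {W : Submodule F V} (r : ℕ) {z z' : V} (hz : z ≠ 0)
    (hz' : z' ≠ 0) (hzW : z ∈ W) (hzW' : z' ∈ W) :
    ((subspacesIn W r).filter (z ∈ ·)).card ≤ ((subspacesIn W r).filter (z' ∈ ·)).card := by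
  obtain ⟨e, he, heW⟩ := exists_linearEquiv_apply_eq_map_le (F := F) hz hz'
  refine Finset.card_le_card_of_injOn (fun H => H.map (e : V →ₗ[F] V)) (fun H hH => ?_)
    ((Submodule.map_injective_of_injective e.injective).injOn)
  rw [Finset.mem_coe, Finset.mem_filter, mem_subspacesIn] at hH ⊢
  exact ⟨⟨(Submodule.map_mono hH.1.1).trans (heW W hzW hzW'),
    (LinearEquiv.finrank_map_eq e H).trans hH.1.2⟩, ⟨z, hH.2, he⟩⟩

variable [Fintype F] [Fintype V]

/-- The proportion of the rank `r` subspaces of `W` that contain a given nonzero vector. -/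
theorem card_filter_mem_subspacesIn_mul_le {W : Submodule F V} (r : ℕ) {z : V} (hz : z ≠ 0)
    (hzW : z ∈ W) :
    ((subspacesIn W r).filter (z ∈ ·)).card * Fintype.card F ^ Module.finrank F W ≤
      (subspacesIn W r).card * Fintype.card F ^ r := by
  set q := Fintype.card F
  set c := ((subspacesIn W r).filter (z ∈ ·)).card
  have hconst (y : V) (hy : y ∈ Finset.univ.filter fun y => y ∈ W ∧ y ≠ 0) :
      ((subspacesIn W r).filter (y ∈ ·)).card = c := by
    rw [Finset.mem_filter] at hy
    exact le_antisymm (card_filter_mem_subspacesIn_le r hy.2.2 hz hy.2.1 hzW)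
      (card_filter_mem_subspacesIn_le r hz hy.2.2 hzW hy.2.1)
  have hdc := Finset.sum_card_bipartiteAbove_eq_sum_card_bipartiteBelow
    (s := Finset.univ.filter fun y : V => y ∈ W ∧ y ≠ 0) (t := subspacesIn W r)
    (fun (y : V) (H : Submodule F V) => y ∈ H)
  simp only [Finset.bipartiteAbove, Finset.bipartiteBelow] at hdc
  rw [Finset.sum_congr rfl hconst, Finset.sum_const, smul_eq_mul] at hdc
  have hcount (H : Submodule F V) :
      (Finset.univ.filter fun y : V => y ∈ H ∧ y ≠ 0).card + 1 = q ^ Module.finrank F H := by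
    rw [← card_filter_mem_submodule H, ← Finset.filter_filter, Finset.filter_ne',
      Finset.card_erase_add_one]
    simp
  have hbelow (H : Submodule F V) (hH : H ∈ subspacesIn W r) :
      ((Finset.univ.filter fun y : V => y ∈ W ∧ y ≠ 0).filter (· ∈ H)).card + 1 = q ^ r := by
    rw [mem_subspacesIn] at hH
    rw [← hH.2, ← hcount H, Finset.filter_filter]
    congr 2
    ext y
    simp only [Finset.mem_filter, Finset.mem_univ, true_and]
    constructor
    · rintro ⟨⟨_, h⟩, h'⟩
      exact ⟨h', h⟩
    · rintro ⟨h, h'⟩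
      exact ⟨⟨hH.1 h, h'⟩, h⟩
  have hsum : ∑ H ∈ subspacesIn W r,
      ((Finset.univ.filter fun y : V => y ∈ W ∧ y ≠ 0).filter (· ∈ H)).card +
      (subspacesIn W r).card = (subspacesIn W r).card * q ^ r := by
    rw [Finset.card_eq_sum_ones, ← Finset.sum_add_distrib, Finset.sum_congr rfl hbelow]
    simp
  -- Double counting gives `c (q ^ dim W - 1) = N (q ^ r - 1)`, where `N` is the number of
  -- subspaces; `c ≤ N` allows both `-1` to be dropped.
  have hc : c ≤ (subspacesIn W r).card := Finset.card_filter_le _ _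
  rw [← hcount W, ← hsum, ← hdc]
  linarith

/-- The second moment of the fibres of `T` modulo a random subspace of `W`. -/
theorem sum_congruentPairs_le {W : Submodule F V} (r : ℕ) {T : Finset V}
    (hT : ∀ x ∈ T, ∀ y ∈ T, x - y ∈ W) :
    (∑ H ∈ subspacesIn W r, (congruentPairs H T : ℝ)) ≤
      (subspacesIn W r).card * (T.card + (T.card : ℝ) ^ 2 *
        (Fintype.card F : ℝ) ^ r / (Fintype.card F : ℝ) ^ Module.finrank F W) := by
  set q := Fintype.card F
  set N := (subspacesIn W r).card
  have hq : (0 : ℝ) < q := by exact_mod_cast Fintype.card_pos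
  have hpair (p : V × V) (hp : p ∈ T ×ˢ T) :
      (((subspacesIn W r).filter (p.1 - p.2 ∈ ·)).card : ℝ) ≤
        (if p.1 = p.2 then (N : ℝ) else 0) + N * (q : ℝ) ^ r / (q : ℝ) ^ Module.finrank F W := by
    rw [Finset.mem_product] at hp
    split_ifs with h
    · refine le_add_of_le_of_nonneg ?_ (by positivity)
      exact_mod_cast Finset.card_filter_le _ _
    · rw [zero_add, le_div_iff₀ (by positivity)]
      exact_mod_cast card_filter_mem_subspacesIn_mul_le r (sub_ne_zero.2 h)
        (hT _ hp.1 _ hp.2)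
  have hdiag : ∑ p ∈ T ×ˢ T, (if p.1 = p.2 then (N : ℝ) else 0) = T.card * N := by
    rw [Finset.sum_product]
    simp
  calc (∑ H ∈ subspacesIn W r, (congruentPairs H T : ℝ))
      = ∑ p ∈ T ×ˢ T, (((subspacesIn W r).filter (p.1 - p.2 ∈ ·)).card : ℝ) := by
        simp only [congruentPairs_eq_sum, Finset.card_filter]
        push_cast
        rw [Finset.sum_comm]
    _ ≤ ∑ p ∈ T ×ˢ T, ((if p.1 = p.2 then (N : ℝ) else 0) +
          N * (q : ℝ) ^ r / (q : ℝ) ^ Module.finrank F W) := Finset.sum_le_sum hpair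
    _ = _ := by
        rw [Finset.sum_add_distrib, hdiag, Finset.sum_const, Finset.card_product, nsmul_eq_mul]
        push_cast
        ring

end Subspaces

/-! ### Projection to a quotient and truncated fibre sizes. -/

section Projection

open scoped Classical

/-- The affine function that maps `a` to `0` and `a + h` to `1`, truncated to `[0, 1]`. -/
noncomputable def truncate (a h t : ℝ) : ℝ := max 0 (min 1 ((t - a) / h))

theorem truncate_nonneg (a h t : ℝ) : 0 ≤ truncate a h t := le_max_left _ _

theorem truncate_le_one (a h t : ℝ) : truncate a h t ≤ 1 :=
  max_le zero_le_one (min_le_left _ _)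

theorem truncate_mono {a h s t : ℝ} (hh : 0 < h) (hst : s ≤ t) : truncate a h s ≤ truncate a h t := by
  unfold truncate
  gcongr

/-- Above `a` one has `t - C ≥ (t - a) + h`, and the square of the right side is at least `4 h (t -
a)`. With `C` the mean fibre size of `S`, this charges the heavy fibres to the variance. -/
theorem truncate_le {a h C : ℝ} (hh : 0 < h) (hC : C + h ≤ a) (t : ℝ) :
    truncate a h t ≤ (t - C) ^ 2 / (4 * h ^ 2) := by
  refine max_le (by positivity) ((min_le_right _ _).trans ?_)
  rcases le_total t a with h1 | h1
  · exact (div_nonpos_of_nonpos_of_nonneg (by linarith) hh.le).trans (by positivity)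
  · rw [div_le_div_iff₀ hh (by positivity)]
    have h2 : (t - a + h) ^ 2 ≤ (t - C) ^ 2 := pow_le_pow_left₀ (by linarith) (by linarith) 2
    have h3 : 4 * h * (t - a) ≤ (t - C) ^ 2 := by nlinarith [sq_nonneg (t - a - h)]
    nlinarith

/-- This is `x ≤ s + x ^ 2 / (4 s)` for `x = (a + h - t) / h`. It is used with `a + h` the mean
fibre size on a rich line; `s` stays free to balance the two losses. -/
theorem one_sub_truncate_le {a h s : ℝ} (hh : 0 < h) (hs : 0 < s) (t : ℝ) :
    1 - truncate a h t ≤ s + (t - (a + h)) ^ 2 / (4 * s * h ^ 2) := by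
  have h0 : 0 ≤ (t - (a + h)) ^ 2 / (4 * s * h ^ 2) := by positivity
  rcases le_total 1 ((t - a) / h) with h1 | h1
  · have : 1 ≤ truncate a h t := le_max_of_le_right (le_min le_rfl h1)
    linarith
  · have h2 : (t - a) / h ≤ truncate a h t := le_max_of_le_right (le_min h1 le_rfl)
    have h3 : 1 - (t - a) / h = (a + h - t) / h := by field_simp; ring
    have h4 : (a + h - t) / h ≤ s + (t - (a + h)) ^ 2 / (4 * s * h ^ 2) := by
      have h5 : s + (t - (a + h)) ^ 2 / (4 * s * h ^ 2) - (a + h - t) / h =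
          (2 * s * h - (a + h - t)) ^ 2 / (4 * s * h ^ 2) := by
        field_simp
        ring
      have h6 : 0 ≤ (2 * s * h - (a + h - t)) ^ 2 / (4 * s * h ^ 2) := by positivity
      linarith
    linarith

variable {F V : Type*} [Field F] [AddCommGroup V] [Module F V]

theorem sum_sq_sub_card_fiber {U : Type*} [AddCommGroup U] [Module F U] [Fintype U]
    [DecidableEq U] (φ : V →ₗ[F] U) (T : Finset V) :
    ∑ y, (((T.filter (φ · = y)).card : ℝ) - T.card / Fintype.card U) ^ 2 =
      congruentPairs (LinearMap.ker φ) T - (T.card : ℝ) ^ 2 / Fintype.card U := by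
  have hU : (0 : ℝ) < Fintype.card U := by exact_mod_cast Fintype.card_pos
  simp only [sub_sq, Finset.sum_add_distrib, Finset.sum_sub_distrib, sum_card_fiber_sq,
    ← Finset.sum_mul, ← Finset.mul_sum, sum_card_fiber]
  rw [Finset.sum_const, Finset.card_univ, nsmul_eq_mul]
  field_simp
  ring

theorem exists_surjective_ker_eq [FiniteDimensional F V] {d : ℕ} {H : Submodule F V}
    (hd : Module.finrank F H + d = Module.finrank F V) :
    ∃ φ : V →ₗ[F] (Fin d → F), Function.Surjective φ ∧ LinearMap.ker φ = H := by
  have h := Submodule.finrank_quotient_add_finrank H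
  have h1 : Module.finrank F (V ⧸ H) = Module.finrank F (Fin d → F) := by
    rw [Module.finrank_fin_fun]
    omega
  let e := LinearEquiv.ofFinrankEq (V ⧸ H) (Fin d → F) h1
  exact ⟨e.toLinearMap.comp H.mkQ, e.surjective.comp H.mkQ_surjective, by
    rw [LinearMap.ker_comp, LinearEquiv.ker, Submodule.comap_bot, Submodule.ker_mkQ]⟩

variable [Fintype F]

/-- The fibres of `T` along a line that contains the image of `T`. -/
theorem sum_sq_sub_card_fiber_line {U : Type*} [AddCommGroup U] [Module F U] [Fintype U]
    [DecidableEq U] (φ : V →ₗ[F] U) (T : Finset V) {u w : U} (hw : w ≠ 0)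
    (hT : ∀ x ∈ T, ∃ t : F, φ x = u + t • w) :
    ∑ t : F, (((T.filter (φ · = u + t • w)).card : ℝ) - T.card / Fintype.card F) ^ 2 =
      congruentPairs (LinearMap.ker φ) T - (T.card : ℝ) ^ 2 / Fintype.card F := by
  have hF : (0 : ℝ) < Fintype.card F := by exact_mod_cast Fintype.card_pos
  have hinj : Function.Injective fun t : F => u + t • w := fun s t hst =>
    smul_left_injective F hw (add_left_cancel hst)
  have hempty (y : U) (hy : y ∉ Set.range fun t : F => u + t • w) : T.filter (φ · = y) = ∅ := by
    rw [Finset.filter_eq_empty_iff]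
    rintro x hx rfl
    obtain ⟨t, ht⟩ := hT x hx
    exact hy ⟨t, ht.symm⟩
  have h1 : ∑ t : F, ((T.filter (φ · = u + t • w)).card : ℝ) = T.card := by
    rw [← sum_card_fiber φ T]
    exact Fintype.sum_of_injective _ hinj _ _ (fun y hy => by rw [hempty y hy]; simp)
      fun _ => rfl
  have h2 : ∑ t : F, ((T.filter (φ · = u + t • w)).card : ℝ) ^ 2 =
      congruentPairs (LinearMap.ker φ) T := by
    rw [← sum_card_fiber_sq φ T]
    exact Fintype.sum_of_injective _ hinj _ _ (fun y hy => by rw [hempty y hy]; simp)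
      fun _ => rfl
  simp only [sub_sq, Finset.sum_add_distrib, Finset.sum_sub_distrib, h2,
    ← Finset.sum_mul, ← Finset.mul_sum, h1]
  rw [Finset.sum_const, Finset.card_univ, nsmul_eq_mul]
  field_simp
  ring

variable [Fintype V]

/-- The Kakeya maximal inequality for a function on a quotient, in the form of a linear lower bound
for its sum. -/
theorem one_le_of_sum_lines {d : ℕ} (hd : d ≠ 0) {H : Submodule F V}
    {φ : V →ₗ[F] (Fin d → F)} (hφ : Function.Surjective φ) (hker : LinearMap.ker φ = H)
    {g : (Fin d → F) → ℝ} (hg0 : ∀ y, 0 ≤ g y) (hg1 : ∀ y, g y ≤ 1) (u : V → (Fin d → F))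
    {n : ℕ} (hn : Module.finrank F H + d = n) :
    1 ≤ (d : ℝ) / (Fintype.card F : ℝ) ^ d +
      d / (Fintype.card F : ℝ) ^ (n + 1) *
        ∑ w with w ∉ H, ∑ t : F, (1 - g (u w + t • φ w)) +
      2 ^ d / (Fintype.card F : ℝ) ^ d * ∑ y, g y := by
  set q : ℝ := (Fintype.card F : ℝ) with hq
  have hq0 : 0 < q := by rw [hq]; exact_mod_cast Fintype.card_pos
  have hcardV : (Fintype.card V : ℝ) = q ^ n := by
    have h1 := φ.finrank_range_add_finrank_ker
    rw [LinearMap.range_eq_top.2 hφ, finrank_top, Module.finrank_fin_fun, hker, add_comm, hn] at h1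
    rw [Module.card_eq_pow_finrank (K := F) (V := V), ← h1]
    push_cast
    rfl
  have hcardH : ((Finset.univ.filter (· ∈ H)).card : ℝ) = q ^ Module.finrank F H := by
    rw [card_filter_mem_submodule]
    push_cast
    rfl
  -- The translates `u` depend on `w : V`, but the maximal inequality allows one line per direction
  -- `φ w`; a line of largest sum serves all `w` in the same class.
  have hmax (w : Fin d → F) : ∃ y, ∀ z, ∑ t : F, g (z + t • w) ≤ ∑ t : F, g (y + t • w) :=
    Finite.exists_max _
  choose y hy using hmax
  have hfib (w : Fin d → F) :
      ((Finset.univ.filter fun x => φ x = w).card : ℝ) = q ^ Module.finrank F H := by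
    obtain ⟨x₀, rfl⟩ := hφ w
    rw [← hcardH]
    congr 1
    refine Finset.card_bij (fun x _ => x - x₀) ?_ ?_ ?_
    · intro x hx
      rw [Finset.mem_filter] at hx ⊢
      refine ⟨Finset.mem_univ _, ?_⟩
      rw [← hker, LinearMap.mem_ker, map_sub, hx.2, sub_self]
    · intro x _ x' _ hxx
      exact sub_left_injective hxx
    · intro x hx
      rw [Finset.mem_filter, ← hker, LinearMap.mem_ker] at hx
      exact ⟨x + x₀, by simp [hx.2], by simp⟩
  set B : ℝ := ∑ x, g x ^ d with hB
  have hB0 : 0 ≤ B := Finset.sum_nonneg fun x _ => pow_nonneg (hg0 x) d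
  have hβd : (B ^ ((d : ℝ)⁻¹)) ^ d = B := Real.rpow_inv_natCast_pow hB0 hd
  set β : ℝ := B ^ ((d : ℝ)⁻¹) with hβ
  have hβ0 : 0 ≤ β := Real.rpow_nonneg hB0 _
  have hkak := sum_lines_le_of_sum_pow_le hd hg0 hβ0 hβd.ge y
  rw [← hq] at hkak
  set X : ℝ := ∑ w with w ∉ H, ∑ t : F, g (u w + t • φ w) with hX
  have hX0 : 0 ≤ X := Finset.sum_nonneg fun _ _ => Finset.sum_nonneg fun _ _ => hg0 _
  have hXle : X ≤ 2 * β * q ^ n := by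
    calc X ≤ ∑ w with w ∉ H, ∑ t : F, g (y (φ w) + t • φ w) :=
          Finset.sum_le_sum fun w _ => hy (φ w) (u w)
      _ = ∑ ω with ω ≠ 0, ∑ w with φ w = ω, ∑ t : F, g (y (φ w) + t • φ w) := by
          rw [← Finset.sum_fiberwise_of_maps_to (s := Finset.univ.filter fun w => w ∉ H)
            (t := Finset.univ.filter fun ω : Fin d → F => ω ≠ 0) (g := φ)]
          · refine Finset.sum_congr rfl fun ω hω => ?_
            rw [Finset.filter_filter]
            refine Finset.sum_congr ?_ fun _ _ => rfl
            ext w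
            simp only [Finset.mem_filter, Finset.mem_univ, true_and, and_iff_right_iff_imp]
            rintro rfl
            rw [← hker, LinearMap.mem_ker]
            exact (Finset.mem_filter.1 hω).2
          · intro w hw
            rw [Finset.mem_filter, ← hker, LinearMap.mem_ker] at hw
            simpa using hw
      _ = ∑ ω with ω ≠ 0, q ^ Module.finrank F H * ∑ t : F, g (y ω + t • ω) := by
          refine Finset.sum_congr rfl fun ω _ => ?_
          rw [← hfib ω, ← nsmul_eq_mul, ← Finset.sum_const]
          refine Finset.sum_congr rfl fun w hw => ?_
          rw [(Finset.mem_filter.1 hw).2]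
      _ ≤ q ^ Module.finrank F H * (2 * β * q ^ d) := by
          rw [← Finset.mul_sum]
          refine mul_le_mul_of_nonneg_left ?_ (by positivity)
          convert hkak
      _ = 2 * β * q ^ n := by rw [← hn, pow_add]; ring
  set ξ : ℝ := X / q ^ (n + 1) with hξ
  have hξ0 : 0 ≤ ξ := by positivity
  have hξβ : ξ ≤ 2 * β / q := by
    rw [hξ, div_le_div_iff₀ (by positivity) hq0, pow_succ]
    nlinarith
  have hξd : ξ ^ d ≤ 2 ^ d / q ^ d * ∑ y, g y := by
    calc ξ ^ d ≤ (2 * β / q) ^ d := pow_le_pow_left₀ hξ0 hξβ d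
      _ = 2 ^ d / q ^ d * B := by rw [div_pow, mul_pow, hβd]; ring
      _ ≤ _ := by
          refine mul_le_mul_of_nonneg_left (Finset.sum_le_sum fun x _ => ?_) (by positivity)
          exact pow_le_of_le_one (hg0 x) (hg1 x) hd
  -- Bernoulli replaces `ξ ^ d` by an expression linear in the line sums, which is what can later be
  -- averaged over `H`.
  have hbern : 1 + (d : ℝ) * (ξ - 1) ≤ ξ ^ d := by
    have := one_add_mul_le_pow (a := ξ - 1) (by linarith) d
    simpa using this
  have hsplit : ∑ w with w ∉ H, ∑ t : F, (1 - g (u w + t • φ w)) =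
      (q ^ n - q ^ Module.finrank F H) * q - X := by
    have hcompl : ((Finset.univ.filter (· ∉ H)).card : ℝ) = q ^ n - q ^ Module.finrank F H := by
      rw [← hcardV, ← hcardH, eq_sub_iff_add_eq, ← Nat.cast_add, add_comm,
        Finset.card_filter_add_card_filter_not, Finset.card_univ]
    rw [← hcompl, hX]
    simp only [Finset.sum_sub_distrib, Finset.sum_const, nsmul_eq_mul, mul_one, Finset.card_univ]
    rfl
  rw [hsplit]
  -- The vectors of `H`, a proportion `q ^ (-d)` of `V`, give no line and cost the term `d / q ^ d`.
  have hfinal : (d : ℝ) / q ^ d + d / q ^ (n + 1) * ((q ^ n - q ^ Module.finrank F H) * q - X) =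
      d * (1 - ξ) := by
    rw [hξ, ← hn, pow_succ, pow_add]
    field_simp
    ring
  rw [hfinal]
  linarith

/-- A necessary condition for `S` to contain, for each `w ∉ H`, a set of `m` points in a translate
of `H ⊔ ⟨w⟩`. -/
theorem one_le_of_forall_subset {d n m : ℕ} (hd : d ≠ 0) {H : Submodule F V}
    (hn : Module.finrank F H + d = n) (hV : Module.finrank F V = n) {S : Finset V}
    {T : Submodule F V → Finset V} {v : Submodule F V → V}
    (hTS : ∀ w ∉ H, T (H ⊔ Submodule.span F {w}) ⊆ S)
    (hTm : ∀ w ∉ H, (T (H ⊔ Submodule.span F {w})).card = m)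
    (hTv : ∀ w ∉ H, ∀ x ∈ T (H ⊔ Submodule.span F {w}),
      x - v (H ⊔ Submodule.span F {w}) ∈ H ⊔ Submodule.span F {w})
    {a h s : ℝ} (hh : 0 < h) (hs : 0 < s) (ham : a + h = (m : ℝ) / Fintype.card F)
    (haS : (S.card : ℝ) / (Fintype.card F : ℝ) ^ d + h ≤ a) :
    1 ≤ (d : ℝ) / (Fintype.card F : ℝ) ^ d +
      d / (Fintype.card F : ℝ) ^ (n + 1) *
        ∑ w with w ∉ H, (Fintype.card F * s +
          (congruentPairs H (T (H ⊔ Submodule.span F {w})) - (m : ℝ) ^ 2 / Fintype.card F) /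
            (4 * s * h ^ 2)) +
      2 ^ d / (Fintype.card F : ℝ) ^ d *
        ((congruentPairs H S - (S.card : ℝ) ^ 2 / (Fintype.card F : ℝ) ^ d) / (4 * h ^ 2)) := by
  obtain ⟨φ, hφ, hker⟩ := exists_surjective_ker_eq (hn.trans hV.symm)
  let g : (Fin d → F) → ℝ := fun y => truncate a h (S.filter (φ · = y)).card
  refine (one_le_of_sum_lines hd hφ hker (g := g) (fun y => truncate_nonneg _ _ _)
    (fun y => truncate_le_one _ _ _) (fun w => φ (v (H ⊔ Submodule.span F {w}))) hn).trans ?_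
  gcongr with w hw
  · rw [Finset.mem_filter] at hw
    set W := H ⊔ Submodule.span F {w} with hW
    have hφw : φ w ≠ 0 := by
      rw [ne_eq, ← LinearMap.mem_ker, hker]
      exact hw.2
    have hline (x) (hx : x ∈ T W) : ∃ t : F, φ x = φ (v W) + t • φ w := by
      obtain ⟨y, hy, z, hz, hyz⟩ := Submodule.mem_sup.1 (hTv w hw.2 x hx)
      obtain ⟨t, rfl⟩ := Submodule.mem_span_singleton.1 hz
      refine ⟨t, ?_⟩
      rw [← hker, LinearMap.mem_ker] at hy
      rw [← map_smul, ← zero_add (φ (t • w)), ← hy, ← map_add, hyz, map_sub, add_sub_cancel]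
    have hvar := sum_sq_sub_card_fiber_line φ (T W) hφw hline
    rw [hker, hTm w hw.2, ← ham] at hvar
    calc ∑ t : F, (1 - g (φ (v W) + t • φ w))
        ≤ ∑ t : F, (s + (((T W).filter (φ · = φ (v W) + t • φ w)).card - (a + h)) ^ 2 /
            (4 * s * h ^ 2)) := by
          refine Finset.sum_le_sum fun t _ => ?_
          refine le_trans ?_ (one_sub_truncate_le hh hs _)
          refine sub_le_sub_left (truncate_mono hh ?_) _
          exact_mod_cast Finset.card_le_card (Finset.filter_subset_filter _ (hTS w hw.2))
      _ = _ := by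
          rw [Finset.sum_add_distrib, ← Finset.sum_div, hvar, Finset.sum_const, Finset.card_univ,
            nsmul_eq_mul]
  · have hvar := sum_sq_sub_card_fiber φ S
    rw [hker] at hvar
    have hcard : (Fintype.card (Fin d → F) : ℝ) = (Fintype.card F : ℝ) ^ d := by simp
    rw [hcard] at hvar
    rw [← hvar, Finset.sum_div]
    exact Finset.sum_le_sum fun y _ => truncate_le hh haS _

end Projection

/-! ### Averaging over nested pairs of subspaces. -/

section Flags

open scoped Classical

variable {F V : Type*} [Field F] [AddCommGroup V] [Module F V] [Fintype (Submodule F V)]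

theorem subspacesIn_top_nonempty {r : ℕ} (hr : r ≤ Module.finrank F V) :
    (subspacesIn (⊤ : Submodule F V) r).Nonempty := by
  obtain ⟨f, hf⟩ := exists_linearIndependent_of_le_finrank hr
  refine ⟨Submodule.span F (Set.range f), mem_subspacesIn.2 ⟨le_top, ?_⟩⟩
  rw [finrank_span_eq_card hf, Fintype.card_fin]

variable [Fintype F] [Fintype V]

/-- Extending the subspaces of rank `r` by one vector enumerates the pairs of nested subspaces of
ranks `r` and `r + 1` uniformly. -/
theorem sum_sup_span_singleton (r : ℕ) (Y : Submodule F V → Submodule F V → ℝ) :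
    ∑ H ∈ subspacesIn (⊤ : Submodule F V) r, ∑ w with w ∉ H, Y H (H ⊔ Submodule.span F {w}) =
      ((Fintype.card F : ℝ) ^ (r + 1) - (Fintype.card F : ℝ) ^ r) *
        ∑ W ∈ subspacesIn (⊤ : Submodule F V) (r + 1), ∑ H ∈ subspacesIn W r, Y H W := by
  have hH (H : Submodule F V) (hHr : H ∈ subspacesIn (⊤ : Submodule F V) r) :
      ∑ w with w ∉ H, Y H (H ⊔ Submodule.span F {w}) =
        ∑ W ∈ (subspacesIn (⊤ : Submodule F V) (r + 1)).filter (H ≤ ·),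
          ((Fintype.card F : ℝ) ^ (r + 1) - (Fintype.card F : ℝ) ^ r) * Y H W := by
    have hHr' := (mem_subspacesIn.1 hHr).2
    rw [← Finset.sum_fiberwise_of_maps_to (s := Finset.univ.filter fun w => w ∉ H)
      (t := (subspacesIn (⊤ : Submodule F V) (r + 1)).filter (H ≤ ·))
      (g := fun w => H ⊔ Submodule.span F {w})]
    · refine Finset.sum_congr rfl fun W hW => ?_
      rw [Finset.mem_filter, mem_subspacesIn] at hW
      have hset : (Finset.univ.filter fun w => w ∉ H).filter
          (fun w => H ⊔ Submodule.span F {w} = W) =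
          Finset.univ.filter (· ∈ W) \ Finset.univ.filter (· ∈ H) := by
        ext w
        simp only [Finset.mem_filter, Finset.mem_univ, true_and, Finset.mem_sdiff]
        constructor
        · rintro ⟨h1, rfl⟩
          exact ⟨Submodule.mem_sup_right (Submodule.mem_span_singleton_self w), h1⟩
        · rintro ⟨h1, h2⟩
          refine ⟨h2, Submodule.eq_of_le_of_finrank_eq
            (sup_le hW.2 ((Submodule.span_singleton_le_iff_mem _ _).2 h1)) ?_⟩
          rw [Submodule.finrank_sup_span_singleton h2, hHr', hW.1.2]
      have hcard : ((Finset.univ.filter (· ∈ W) \ Finset.univ.filter (· ∈ H)).card : ℝ) =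
          (Fintype.card F : ℝ) ^ (r + 1) - (Fintype.card F : ℝ) ^ r := by
        rw [Finset.cast_card_sdiff (fun w hw => by
          simp only [Finset.mem_filter, Finset.mem_univ, true_and] at hw ⊢
          exact hW.2 hw), card_filter_mem_submodule, card_filter_mem_submodule, hW.1.2, hHr']
        push_cast
        rfl
      rw [Finset.sum_congr rfl fun w hw => by rw [(Finset.mem_filter.1 hw).2], Finset.sum_const,
        nsmul_eq_mul, hset, hcard]
    · intro w hw
      rw [Finset.mem_filter] at hw
      rw [Finset.mem_filter, mem_subspacesIn, Submodule.finrank_sup_span_singleton hw.2, hHr']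
      exact ⟨⟨le_top, rfl⟩, le_sup_left⟩
  rw [Finset.sum_congr rfl hH, Finset.mul_sum]
  simp only [Finset.mul_sum]
  refine Finset.sum_comm' fun H W => ?_
  simp only [mem_subspacesIn, Finset.mem_filter, le_top, true_and]
  tauto

/-- The second moment bound for a family of sets `T W` in translates of the subspaces `W` of rank
`r + 1`, averaged over all pairs of nested subspaces. -/
theorem sum_sum_congruentPairs_sub_le {r m : ℕ} {T : Submodule F V → Finset V}
    (hTm : ∀ W : Submodule F V, Module.finrank F W = r + 1 → (T W).card = m)
    (hT : ∀ W : Submodule F V, Module.finrank F W = r + 1 → ∀ x ∈ T W, ∀ y ∈ T W, x - y ∈ W) :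
    ∑ H ∈ subspacesIn (⊤ : Submodule F V) r, ∑ w with w ∉ H,
      ((congruentPairs H (T (H ⊔ Submodule.span F {w})) : ℝ) - (m : ℝ) ^ 2 / Fintype.card F) ≤
      (subspacesIn (⊤ : Submodule F V) r).card * (Fintype.card V * m) := by
  have hq1 : (1 : ℝ) ≤ Fintype.card F := by exact_mod_cast Fintype.card_pos
  have hq0 : (0 : ℝ) < Fintype.card F := by linarith
  rw [sum_sup_span_singleton r fun H W => (congruentPairs H (T W) : ℝ) - (m : ℝ) ^ 2 /
    Fintype.card F]
  -- The off-diagonal term `m ^ 2 q ^ r / q ^ (r + 1)` is exactly the subtracted `m ^ 2 / q`; only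
  -- the diagonal `m` is left.
  have hW (W : Submodule F V) (hWr : W ∈ subspacesIn (⊤ : Submodule F V) (r + 1)) :
      ∑ H ∈ subspacesIn W r, ((congruentPairs H (T W) : ℝ) - (m : ℝ) ^ 2 / Fintype.card F) ≤
        ∑ H ∈ subspacesIn W r, (m : ℝ) := by
    have hWr' := (mem_subspacesIn.1 hWr).2
    have h := sum_congruentPairs_le r (hT W hWr')
    rw [hTm W hWr', hWr'] at h
    rw [Finset.sum_sub_distrib, Finset.sum_const, Finset.sum_const, nsmul_eq_mul, nsmul_eq_mul,
      sub_le_iff_le_add]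
    refine h.trans (le_of_eq ?_)
    rw [pow_succ]
    field_simp
    ring
  calc _ ≤ ((Fintype.card F : ℝ) ^ (r + 1) - (Fintype.card F : ℝ) ^ r) *
        ∑ W ∈ subspacesIn (⊤ : Submodule F V) (r + 1), ∑ H ∈ subspacesIn W r, (m : ℝ) := by
        refine mul_le_mul_of_nonneg_left (Finset.sum_le_sum hW) ?_
        exact sub_nonneg.2 (pow_le_pow_right₀ hq1 r.le_succ)
    _ = ∑ H ∈ subspacesIn (⊤ : Submodule F V) r, ∑ w with w ∉ H, (m : ℝ) :=
        (sum_sup_span_singleton r fun _ _ => (m : ℝ)).symm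
    _ ≤ ∑ H ∈ subspacesIn (⊤ : Submodule F V) r, ∑ w : V, (m : ℝ) :=
        Finset.sum_le_sum fun H _ => Finset.sum_le_sum_of_subset_of_nonneg
          (Finset.filter_subset _ _) fun _ _ _ => by positivity
    _ = _ := by simp

/-- A necessary condition for `S` to contain `m` points in a translate of each subspace of rank
`r + 1`. -/
theorem one_le_of_rich_translates {d n r m : ℕ} (hd : d ≠ 0) (hn : r + d = n)
    (hV : Module.finrank F V = n) {S : Finset V} {T : Submodule F V → Finset V}
    {v : Submodule F V → V}
    (hTS : ∀ W : Submodule F V, Module.finrank F W = r + 1 → T W ⊆ S)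
    (hTm : ∀ W : Submodule F V, Module.finrank F W = r + 1 → (T W).card = m)
    (hTv : ∀ W : Submodule F V, Module.finrank F W = r + 1 → ∀ x ∈ T W, x - v W ∈ W)
    {a h s : ℝ} (hh : 0 < h) (hs : 0 < s) (ham : a + h = (m : ℝ) / Fintype.card F)
    (haS : (S.card : ℝ) / (Fintype.card F : ℝ) ^ d + h ≤ a) :
    1 ≤ (d : ℝ) / (Fintype.card F : ℝ) ^ d +
      d * (s + (m : ℝ) / Fintype.card F / (4 * s * h ^ 2)) +
      2 ^ d * ((S.card : ℝ) / (Fintype.card F : ℝ) ^ d / (4 * h ^ 2)) := by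
  set q : ℝ := (Fintype.card F : ℝ) with hq
  have hq0 : 0 < q := by rw [hq]; exact_mod_cast Fintype.card_pos
  set G := subspacesIn (⊤ : Submodule F V) r
  have hG : (0 : ℝ) < G.card := by
    exact_mod_cast (subspacesIn_top_nonempty (by omega)).card_pos
  have hcardV : (Fintype.card V : ℝ) = q ^ n := by
    rw [Module.card_eq_pow_finrank (K := F) (V := V), hV]
    push_cast
    rfl
  have hrank {H : Submodule F V} (hH : H ∈ G) {w : V} (hw : w ∉ H) :
      Module.finrank F ↥(H ⊔ Submodule.span F {w}) = r + 1 := by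
    rw [Submodule.finrank_sup_span_singleton hw, (mem_subspacesIn.1 hH).2]
  have hone (H : Submodule F V) (hH : H ∈ G) := one_le_of_forall_subset hd
    (((congrArg (· + d) (mem_subspacesIn.1 hH).2)).trans hn) hV
    (fun w hw => hTS _ (hrank hH hw)) (fun w hw => hTm _ (hrank hH hw))
    (fun w hw => hTv _ (hrank hH hw)) hh hs ham haS
  rw [← hq] at hone
  let A (H : Submodule F V) : ℝ := ∑ w with w ∉ H,
    ((congruentPairs H (T (H ⊔ Submodule.span F {w})) : ℝ) - (m : ℝ) ^ 2 / q)
  -- Apart from constants, `H` enters only linearly through `A H` and `congruentPairs H S`, whose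
  -- averages are bounded below by `h1` and `h2`.
  have hlin (H : Submodule F V) (hH : H ∈ G) :
      1 ≤ ((d : ℝ) / q ^ d + d * s - 2 ^ d / q ^ d * ((S.card : ℝ) ^ 2 / q ^ d / (4 * h ^ 2))) +
        d / q ^ (n + 1) / (4 * s * h ^ 2) * A H +
        2 ^ d / q ^ d / (4 * h ^ 2) * congruentPairs H S := by
    refine (hone H hH).trans ?_
    have hle : ∑ w with w ∉ H, (q * s +
        ((congruentPairs H (T (H ⊔ Submodule.span F {w})) : ℝ) - (m : ℝ) ^ 2 / q) /
          (4 * s * h ^ 2)) ≤ q ^ n * (q * s) + A H / (4 * s * h ^ 2) := by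
      rw [Finset.sum_add_distrib, ← Finset.sum_div, Finset.sum_const, nsmul_eq_mul]
      refine add_le_add_left (mul_le_mul_of_nonneg_right ?_ (by positivity)) _
      rw [← hcardV]
      exact_mod_cast Finset.card_le_univ _
    have := mul_le_mul_of_nonneg_left hle (by positivity : 0 ≤ (d : ℝ) / q ^ (n + 1))
    have e1 : (d : ℝ) / q ^ (n + 1) * (q ^ n * (q * s) + A H / (4 * s * h ^ 2)) =
        d * s + d / q ^ (n + 1) / (4 * s * h ^ 2) * A H := by
      rw [pow_succ]
      field_simp
    rw [e1] at this
    have e2 : (2 : ℝ) ^ d / q ^ d *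
        ((congruentPairs H S - (S.card : ℝ) ^ 2 / q ^ d) / (4 * h ^ 2)) =
        2 ^ d / q ^ d / (4 * h ^ 2) * congruentPairs H S -
          2 ^ d / q ^ d * ((S.card : ℝ) ^ 2 / q ^ d / (4 * h ^ 2)) := by
      ring
    rw [e2]
    linarith
  have hsum := Finset.sum_le_sum hlin
  simp only [Finset.sum_add_distrib, ← Finset.mul_sum, Finset.sum_const, nsmul_eq_mul, mul_one]
    at hsum
  have hT' : ∀ W : Submodule F V, Module.finrank F W = r + 1 → ∀ x ∈ T W, ∀ y ∈ T W, x - y ∈ W := by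
    intro W hW x hx y hy
    have := W.sub_mem (hTv W hW x hx) (hTv W hW y hy)
    rwa [sub_sub_sub_cancel_right] at this
  have h1 := sum_sum_congruentPairs_sub_le hTm hT'
  rw [hcardV, ← hq] at h1
  have h2 := sum_congruentPairs_le (W := (⊤ : Submodule F V)) r (T := S) fun _ _ _ _ => trivial
  rw [finrank_top, hV, ← hq] at h2
  have h1' := mul_le_mul_of_nonneg_left h1
    (by positivity : 0 ≤ (d : ℝ) / q ^ (n + 1) / (4 * s * h ^ 2))
  have h2' := mul_le_mul_of_nonneg_left h2
    (by positivity : 0 ≤ (2 : ℝ) ^ d / q ^ d / (4 * h ^ 2))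
  have hfin := hsum.trans (add_le_add (add_le_add_right h1' _) h2')
  refine le_of_mul_le_mul_left ?_ hG
  rw [mul_one]
  refine hfin.trans (le_of_eq ?_)
  rw [← hn, pow_succ, pow_add]
  field_simp
  ring

end Flags

/-! ### Choice of parameters and conclusion. -/

/-- Equality holds at `d = 1`. Passing from `d = 0` to `1` multiplies the square by `9 / 4 > 2`, so
doubling the bound is enough only from `d = 1` on. -/
theorem eight_mul_add_two_sq_le (d : ℕ) : 8 * (d + 2) ^ 2 ≤ 9 * 2 ^ (d + 2) := by
  induction d with
  | zero => norm_num
  | succ d ih =>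
    rcases Nat.lt_or_ge d 1 with h | h
    · interval_cases d
      norm_num
    · rw [show d + 1 + 2 = d + 2 + 1 by omega, pow_succ 2]
      nlinarith

theorem mainTheorem6 {F : Type*} [Field F] [Finite F] (q : ℕ) (hq : Nat.card F = q)
    (ε : ℝ) (hε : 0 < ε) (n k m : ℕ) (hk : 2 ≤ k) (hkn : k < n) (hmq : m ≤ q ^ k)
    (hm : (2 : ℝ) ^ (n + 7 - k) * (q : ℝ) * (ε ^ 2)⁻¹ ≤ (m : ℝ)) :
    (1 - ε) * (m : ℝ) * (q : ℝ) ^ (n - k) ≤ (furstenbergNumber F n k m : ℝ) := by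
  classical
  have := Fintype.ofFinite F
  have := Fintype.ofFinite (Submodule F (Fin n → F))
  obtain ⟨⟨S, hS, hScard⟩, -⟩ := isLeast_furstenbergNumber (F := F) (n := n) (k := k) (m := m)
    (by rwa [hq])
  rw [← hScard]
  by_contra! hlt
  have hqF : Fintype.card F = q := by rw [← hq, Nat.card_eq_fintype_card]
  have hq2 : (2 : ℝ) ≤ q := by
    rw [← hqF]
    exact_mod_cast Fintype.one_lt_card (α := F)
  have hq0 : (0 : ℝ) < q := by linarith
  obtain ⟨d, rfl⟩ : ∃ d, n = k + 1 + d := ⟨n - k - 1, by omega⟩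
  obtain ⟨r, rfl⟩ : ∃ r, k = r + 1 := ⟨k - 1, by omega⟩
  rw [show r + 1 + 1 + d - (r + 1) = d + 1 by omega] at hlt
  rw [show r + 1 + 1 + d + 7 - (r + 1) = d + 2 + 6 by omega] at hm
  have hrich (W : Submodule F (Fin (r + 1 + 1 + d) → F)) : ∃ (T : Finset (Fin (r + 1 + 1 + d) → F)) (v : Fin (r + 1 + 1 + d) → F),
      Module.finrank F W = r + 1 → T ⊆ S.toFinset ∧ T.card = m ∧ ∀ x ∈ T, x - v ∈ W := by
    by_cases hW : Module.finrank F W = r + 1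
    · obtain ⟨v, hv⟩ := hS W hW
      rw [Set.ncard_eq_toFinset_card'] at hv
      obtain ⟨T, hT, hTm⟩ := Finset.exists_subset_card_eq hv
      refine ⟨T, v, fun _ => ⟨fun x hx => ?_, hTm, fun x hx => ?_⟩⟩
      · have := hT hx
        rw [Set.mem_toFinset] at this ⊢
        exact this.1
      · have := hT hx
        rw [Set.mem_toFinset] at this
        obtain ⟨y, hy, rfl⟩ := this.2
        simpa using hy
    · exact ⟨∅, 0, fun h => absurd h hW⟩
  choose T v hTv using hrich
  set c : ℝ := (m : ℝ) / q with hc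
  have hcε : (2 : ℝ) ^ (d + 2 + 6) ≤ ε ^ 2 * c := by
    rw [hc, mul_div_assoc', le_div_iff₀ hq0]
    rwa [← div_eq_mul_inv, div_le_iff₀ (by positivity), mul_comm (m : ℝ)] at hm
  have hc0 : 0 < c := by
    have : 0 < ε ^ 2 * c := lt_of_lt_of_le (by positivity) hcε
    exact (mul_pos_iff_of_pos_left (by positivity)).1 this
  have hSc : (S.toFinset.card : ℝ) / (q : ℝ) ^ (d + 2) < (1 - ε) * c := by
    rw [div_lt_iff₀ (by positivity), ← Set.ncard_eq_toFinset_card']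
    refine hlt.trans_eq ?_
    rw [hc]
    field_simp
    ring
  -- The cutoffs `a` and `a + h` divide the gap between `(1 - ε) c` and `c` into halves of length `h
  -- = ε c / 2`. The choice of `s` makes its loss `D * s` equal to `1 / 4`.
  have h := one_le_of_rich_translates (F := F) (V := Fin (r + 1 + 1 + d) → F)
    (d := d + 2) (n := r + 1 + 1 + d) (r := r)
    (m := m) (by omega) (by omega) (Module.finrank_fin_fun F) (S := S.toFinset) (T := T) (v := v)
    (fun W hW => (hTv W hW).1) (fun W hW => (hTv W hW).2.1) (fun W hW => (hTv W hW).2.2)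
    (a := (1 - ε / 2) * c) (h := ε * c / 2) (s := 1 / (4 * ((d + 2 : ℕ) : ℝ))) (by positivity)
    (by positivity) (by rw [hqF, ← hc]; ring) (by rw [hqF]; linarith)
  rw [hqF, ← hc] at h
  set D := d + 2 with hD
  have hD0 : (0 : ℝ) < D := by exact_mod_cast (by omega : 0 < D)
  have hsq : (D : ℝ) ^ 2 ≤ 9 / 8 * 2 ^ D := by
    have : 8 * D ^ 2 ≤ 9 * 2 ^ D := by
      exact eight_mul_add_two_sq_le d
    have : (8 : ℝ) * (D : ℝ) ^ 2 ≤ 9 * 2 ^ D := by exact_mod_cast this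
    linarith
  have hlin : (D : ℝ) / (q : ℝ) ^ D ≤ 1 / 2 := by
    have h1 : 2 * D ≤ 2 ^ D := by
      rw [hD, pow_succ, mul_comm]
      exact Nat.mul_le_mul_right _ Nat.lt_two_pow_self
    have h2 : (2 : ℝ) * D ≤ 2 ^ D := by exact_mod_cast h1
    have h3 : (2 : ℝ) ^ D ≤ (q : ℝ) ^ D := pow_le_pow_left₀ (by norm_num) hq2 D
    rw [div_le_iff₀ (by positivity)]
    linarith
  have h64 : (2 : ℝ) ^ D * (1 / (ε ^ 2 * c)) ≤ 1 / 64 := by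
    rw [mul_one_div, div_le_div_iff₀ (by positivity) (by norm_num)]
    rw [pow_add] at hcε
    linarith
  have hloss : (D : ℝ) * (1 / (4 * (D : ℝ)) + c / (4 * (1 / (4 * (D : ℝ))) * (ε * c / 2) ^ 2)) ≤
      1 / 4 + 9 / 128 := by
    have e : (D : ℝ) * (1 / (4 * (D : ℝ)) + c / (4 * (1 / (4 * (D : ℝ))) * (ε * c / 2) ^ 2)) =
        1 / 4 + 4 * ((D : ℝ) ^ 2 * (1 / (ε ^ 2 * c))) := by
      field_simp
      ring
    rw [e]
    have := mul_le_mul_of_nonneg_right hsq (by positivity : 0 ≤ 1 / (ε ^ 2 * c))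
    linarith
  have hmain : (2 : ℝ) ^ D * ((S.toFinset.card : ℝ) / (q : ℝ) ^ D / (4 * (ε * c / 2) ^ 2)) ≤
      1 / 64 := by
    refine le_trans (mul_le_mul_of_nonneg_left ?_ (by positivity)) h64
    have h1 : (S.toFinset.card : ℝ) / (q : ℝ) ^ D ≤ c := by nlinarith
    calc (S.toFinset.card : ℝ) / (q : ℝ) ^ D / (4 * (ε * c / 2) ^ 2)
        ≤ c / (4 * (ε * c / 2) ^ 2) := by gcongr
      _ = 1 / (ε ^ 2 * c) := by field_simp; ring
  -- The losses add up to `1 / 2 + (1 / 4 + 9 / 128) + 1 / 64 = 107 / 128 < 1`.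
  linarith
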